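/- There is an absolute constant $C>0$ with the following property. Let $f:\mathbb{R}^2\to\{-1,+1\}$ be any function that is constant on each cell $x+[0,1)^2$, $x\in\mathbb{Z}^2$. Then for arbitrarily large $R>0$ there is a circular arc $I$ of radius $R$ such that $$\left|\int_I f\right|\ge C\sqrt{R},$$ where the integral is taken with respect to arc length on $I$. -/

import Mathlib

/-- The Euclidean plane. -/
abbrev Plane : Type := EuclideanSpace ℝ (Fin 2)

/-- The unit cell `x + [0,1)²` of the checkerboard with lower left corner `x = (m, n) ∈ ℤ²`. -/
def unitCell (m n : ℤ) : Set Plane :=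
  {p | p 0 ∈ Set.Ico (m : ℝ) (m + 1) ∧ p 1 ∈ Set.Ico (n : ℝ) (n + 1)}

/-- A coloring of the infinite checkerboard: a function on the plane with values `-1` and `+1`
which is constant in each unit cell. -/
structure IsCheckerboardColoring (f : Plane → ℝ) : Prop where
  eq_or_eq : ∀ p, f p = -1 ∨ f p = 1
  const_on_cell : ∀ m n : ℤ, ∀ p ∈ unitCell m n, ∀ q ∈ unitCell m n, f p = f q

/-- A (nondegenerate, proper) circular arc: the part of the circle with the given center and
radius whose polar angle about the center runs from `startAngle` to `endAngle`. -/
structure CircularArc where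
  center : Plane
  radius : ℝ
  startAngle : ℝ
  endAngle : ℝ
  radius_pos : 0 < radius
  angle_lt : startAngle < endAngle
  angle_lt_add : endAngle < startAngle + 2 * Real.pi

namespace CircularArc

/-- The point of the circle carrying the arc `I` at polar angle `θ` about the center. -/
noncomputable def point (I : CircularArc) (θ : ℝ) : Plane :=
  I.center + I.radius • !₂[Real.cos θ, Real.sin θ]

/-- The integral of `f` over the arc `I` with respect to arc length, `ds = radius * dθ`. -/
noncomputable def integral (I : CircularArc) (f : Plane → ℝ) : ℝ :=
  ∫ θ in I.startAngle..I.endAngle, f (I.point θ) * I.radius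

end CircularArc

/-!
The proof is a second moment argument over circles of varying centre and radius. Identify the plane
with `ℂ`, let `F` be the coloring cut off to a disc of radius `N`, and let `circleEnergy F N` be the
integral of `(∫ F(x + N (u' - u) exp(it)) dt)²` over all `x ∈ ℂ` and all `u`, `u'` in the unit disc,
that is, over circles of centre `x` and radius `N |u' - u|`. Expanding the square and integrating
over `x` first leaves the autocorrelation of `F` at `N (exp(it') - exp(it)) (u' - u)`, integrated
over `t`, `t'`, `u`, `u'`. This is symmetric in the roles of the angles and of the points of the
unit disc, so the energy is also the integral over `t`, `t'` of the energy of the disc averages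
`∫ F(x + N (exp(it') - exp(it)) u) du` (`integral_energy_comm`).

In the second form every term is nonnegative, and the pairs with `|t' - t| ≤ 1/(4N)` involve discs
of radius at most `1/4`; such a disc usually lies within one cell, where `F` is constant, so these
pairs contribute an amount of order `N⁻¹ * N² = N` (`circleEnergy_ge`).

In the first form, the part of a circle inside a disc is one arc or all of the circle, so if all
arcs of radius `R > ρ` had an integral of absolute value at most `C √R` with respect to arc length,
the integral of `F` over such a circle with respect to the angle would be at most `2 C / √R`
(`abs_circle_integral_indicator_le`). As `1/|u' - u|` is integrable, the energy would be at most a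
constant times `C² N + ρ²` (`circleEnergy_le`). For small `C` and large `N` this is a contradiction.
-/

open MeasureTheory

/-! ### Autocorrelation and averages of translates -/

/-- The autocorrelation `v ↦ ∫ F(x) F(x + v) dx` of a function on the plane. -/
noncomputable def autocorr (F : ℂ → ℝ) (v : ℂ) : ℝ := ∫ x, F x * F (x + v)

theorem measurable_autocorr {F : ℂ → ℝ} (hm : Measurable F) : Measurable (autocorr F) := by
  have h : StronglyMeasurable (Function.uncurry fun v x : ℂ => F x * F (x + v)) :=
    Measurable.stronglyMeasurable (by unfold Function.uncurry; fun_prop)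
  exact h.integral_prod_right.measurable

theorem abs_autocorr_le {F : ℂ → ℝ} (hi : Integrable F) (hb : ∀ x, |F x| ≤ 1) (v : ℂ) :
    |autocorr F v| ≤ ∫ x, |F x| := by
  refine norm_integral_le_of_norm_le (f := fun x => F x * F (x + v)) hi.abs
    (Filter.Eventually.of_forall fun x => ?_)
  rw [Real.norm_eq_abs, abs_mul]
  exact mul_le_of_le_one_right (abs_nonneg _) (hb _)

section Average

variable {Θ : Type*} [MeasurableSpace Θ] {μ : Measure Θ} [IsFiniteMeasure μ]

theorem integrable_translate_mul_translate {F : ℂ → ℝ} (hm : Measurable F) (hi : Integrable F)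
    (hb : ∀ x, |F x| ≤ 1) {p : Θ → ℂ} (hp : Measurable p) :
    Integrable (fun z : ℂ × Θ × Θ => F (z.1 + p z.2.1) * F (z.1 + p z.2.2))
      (volume.prod (μ.prod μ)) := by
  have hmeas : Measurable fun z : ℂ × Θ × Θ => F (z.1 + p z.2.1) * F (z.1 + p z.2.2) := by
    fun_prop
  refine (integrable_prod_iff' hmeas.aestronglyMeasurable).2
    ⟨Filter.Eventually.of_forall fun y => ?_, ?_⟩
  · exact (hi.comp_add_right (p y.2)).bdd_mul (c := 1)
      (Measurable.aestronglyMeasurable (by fun_prop)) (Filter.Eventually.of_forall fun x => hb _)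
  · refine Integrable.of_bound (hmeas.norm.stronglyMeasurable.integral_prod_left.aestronglyMeasurable)
      (∫ x, |F x|) (Filter.Eventually.of_forall fun y => ?_)
    rw [Real.norm_of_nonneg (integral_nonneg fun _ => norm_nonneg _)]
    rw [← integral_add_right_eq_self (fun x => |F x|) (p y.2)]
    refine integral_mono_of_nonneg (Filter.Eventually.of_forall fun _ => norm_nonneg _)
      (hi.comp_add_right (p y.2)).abs (Filter.Eventually.of_forall fun x => ?_)
    simp only [Real.norm_eq_abs, abs_mul]
    exact mul_le_of_le_one_left (abs_nonneg _) (hb _)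

theorem sq_average_eq (F : ℂ → ℝ) (p : Θ → ℂ) (x : ℂ) :
    (∫ t, F (x + p t) ∂μ) ^ 2 = ∫ z : Θ × Θ, F (x + p z.1) * F (x + p z.2) ∂(μ.prod μ) := by
  rw [sq, ← integral_prod_mul]

theorem integrable_sq_average {F : ℂ → ℝ} (hm : Measurable F) (hi : Integrable F)
    (hb : ∀ x, |F x| ≤ 1) {p : Θ → ℂ} (hp : Measurable p) :
    Integrable fun x => (∫ t, F (x + p t) ∂μ) ^ 2 := by
  simp only [sq_average_eq]
  exact (integrable_translate_mul_translate hm hi hb hp).integral_prod_left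

theorem integral_sq_average {F : ℂ → ℝ} (hm : Measurable F) (hi : Integrable F)
    (hb : ∀ x, |F x| ≤ 1) {p : Θ → ℂ} (hp : Measurable p) :
    ∫ x, (∫ t, F (x + p t) ∂μ) ^ 2 = ∫ z : Θ × Θ, autocorr F (p z.2 - p z.1) ∂(μ.prod μ) := by
  simp only [sq_average_eq]
  rw [integral_integral_swap
    (f := fun x (z : Θ × Θ) => F (x + p z.1) * F (x + p z.2))
    (integrable_translate_mul_translate hm hi hb hp)]
  refine integral_congr_ae (Filter.Eventually.of_forall fun z => ?_)
  simp only [autocorr]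
  rw [← integral_add_right_eq_self (fun x => F x * F (x + (p z.2 - p z.1))) (p z.1)]
  simp only [add_assoc, add_sub_cancel]

/-- The duality behind the proof. The points `x + (r u' - r u) q t` form a translate of a scaled
copy of `q`, and the points `x + (q t' - q t) r u` one of `r`. Both ways the integral over `x` of the
squared averages of `F` comes down to the autocorrelation of `F` at `(q t' - q t) (r u' - r u)`, so
the total energies agree. -/
theorem integral_energy_comm {U : Type*} [MeasurableSpace U] {ν : Measure U} [IsFiniteMeasure ν]
    {F : ℂ → ℝ} (hm : Measurable F) (hi : Integrable F)
    (hb : ∀ x, |F x| ≤ 1) {q : Θ → ℂ} (hq : Measurable q) {r : U → ℂ} (hr : Measurable r) :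
    ∫ w : U × U, (∫ x, (∫ t, F (x + (r w.2 - r w.1) * q t) ∂μ) ^ 2) ∂(ν.prod ν) =
      ∫ z : Θ × Θ, (∫ x, (∫ u, F (x + (q z.2 - q z.1) * r u) ∂ν) ^ 2) ∂(μ.prod μ) := by
  have h1 : ∀ w : U × U, ∫ x, (∫ t, F (x + (r w.2 - r w.1) * q t) ∂μ) ^ 2 =
      ∫ z : Θ × Θ, autocorr F ((q z.2 - q z.1) * (r w.2 - r w.1)) ∂(μ.prod μ) := fun w => by
    rw [integral_sq_average hm hi hb (hq.const_mul _)]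
    simp only [mul_comm (r w.2 - r w.1), sub_mul]
  have h2 : ∀ z : Θ × Θ, ∫ x, (∫ u, F (x + (q z.2 - q z.1) * r u) ∂ν) ^ 2 =
      ∫ w : U × U, autocorr F ((q z.2 - q z.1) * (r w.2 - r w.1)) ∂(ν.prod ν) := fun z => by
    rw [integral_sq_average hm hi hb (hr.const_mul _)]
    simp only [mul_sub]
  simp only [h1, h2]
  refine integral_integral_swap
    (f := fun (w : U × U) (z : Θ × Θ) => autocorr F ((q z.2 - q z.1) * (r w.2 - r w.1))) ?_
  have := measurable_autocorr hm
  exact Integrable.of_bound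
    (Measurable.aestronglyMeasurable (by unfold Function.uncurry; fun_prop)) (∫ x, |F x|)
    (Filter.Eventually.of_forall fun z => abs_autocorr_le hi hb _)

theorem integrable_energy {U : Type*} [MeasurableSpace U] {ν : Measure U} [IsFiniteMeasure ν]
    {F : ℂ → ℝ} (hm : Measurable F) (hi : Integrable F)
    (hb : ∀ x, |F x| ≤ 1) {q : Θ → ℂ} (hq : Measurable q) {r : U → ℂ} (hr : Measurable r) :
    Integrable (fun z : Θ × Θ => ∫ x, (∫ u, F (x + (q z.2 - q z.1) * r u) ∂ν) ^ 2)
      (μ.prod μ) := by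
  have h2 : ∀ z : Θ × Θ, ∫ x, (∫ u, F (x + (q z.2 - q z.1) * r u) ∂ν) ^ 2 =
      ∫ w : U × U, autocorr F ((q z.2 - q z.1) * (r w.2 - r w.1)) ∂(ν.prod ν) := fun z => by
    rw [integral_sq_average hm hi hb (hr.const_mul _)]
    simp only [mul_sub]
  simp only [h2]
  have := measurable_autocorr hm
  refine Integrable.integral_prod_left (f := fun z : (Θ × Θ) × (U × U) =>
    autocorr F ((q z.1.2 - q z.1.1) * (r z.2.2 - r z.2.1))) ?_
  exact Integrable.of_bound (Measurable.aestronglyMeasurable (by fun_prop)) (∫ x, |F x|)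
    (Filter.Eventually.of_forall fun z => abs_autocorr_le hi hb _)

end Average

/-! ### Circles meeting a disc -/

/-- Of the directions `t ∈ (0, 2π)`, those with `a + b cos t < d` form an interval symmetric about
`π`, when `b ≥ 0`. -/
theorem exists_forall_add_mul_cos_lt_iff (a d : ℝ) {b : ℝ} (hb : 0 ≤ b) :
    ∃ τ ∈ Set.Icc 0 Real.pi, ∀ t ∈ Set.Ioo 0 (2 * Real.pi),
      a + b * Real.cos t < d ↔ τ < t ∧ t < 2 * Real.pi - τ := by
  have hpi := Real.pi_pos
  rcases hb.eq_or_lt with rfl | hb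
  · by_cases h : a < d
    · exact ⟨0, ⟨le_rfl, hpi.le⟩, fun t ht => by simp [h, ht.1, ht.2]⟩
    · refine ⟨Real.pi, ⟨hpi.le, le_rfl⟩, fun t ht => ?_⟩
      simp only [zero_mul, add_zero, h, false_iff]
      rintro ⟨h1, h2⟩
      linarith
  · set c := (d - a) / b with hc
    have hlt : ∀ t, a + b * Real.cos t < d ↔ Real.cos t < c := fun t => by
      rw [hc, lt_div_iff₀ hb]
      constructor <;> intro h <;> linarith
    -- `arccos` clamps its argument, which takes care of `c ∉ [-1, 1]`.
    have half : ∀ t ∈ Set.Ioc 0 Real.pi, Real.cos t < c ↔ Real.arccos c < t := by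
      intro t ht
      rcases lt_or_ge c (-1) with h1 | h1
      · rw [Real.arccos_of_le_neg_one h1.le]
        exact ⟨fun h => absurd h (by linarith [Real.neg_one_le_cos t]),
          fun h => absurd h (by linarith [ht.2])⟩
      rcases lt_or_ge 1 c with h2 | h2
      · rw [Real.arccos_of_one_le h2.le]
        exact ⟨fun _ => ht.1, fun _ => (Real.cos_le_one t).trans_lt h2⟩
      · conv_lhs => rw [← Real.cos_arccos h1 h2]
        exact Real.strictAntiOn_cos.lt_iff_gt ⟨ht.1.le, ht.2⟩
          ⟨Real.arccos_nonneg c, Real.arccos_le_pi c⟩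
    refine ⟨Real.arccos c, ⟨Real.arccos_nonneg c, Real.arccos_le_pi c⟩, fun t ht => ?_⟩
    rw [hlt]
    rcases le_or_gt t Real.pi with h | h
    · rw [half t ⟨ht.1, h⟩]
      refine ⟨fun h1 => ⟨h1, by linarith⟩, fun h1 => h1.1⟩
    · have := half (2 * Real.pi - t) ⟨by linarith [ht.2], by linarith⟩
      rw [Real.cos_two_pi_sub] at this
      rw [this]
      have := Real.arccos_le_pi c
      exact ⟨fun h1 => ⟨by linarith, by linarith⟩, fun h1 => by linarith [h1.2]⟩

theorem norm_sq_add_mul_exp_mul_I (ρ r β t : ℝ) :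
    ‖(ρ * Complex.exp (β * Complex.I) + r * Complex.exp ((t + β : ℝ) * Complex.I) : ℂ)‖ ^ 2 =
      ρ ^ 2 + r ^ 2 + 2 * r * ρ * Real.cos t := by
  have h : (ρ * Complex.exp (β * Complex.I) + r * Complex.exp ((t + β : ℝ) * Complex.I) : ℂ) =
      (ρ + r * Complex.exp (t * Complex.I)) * Complex.exp (β * Complex.I) := by
    push_cast
    rw [add_mul, Complex.exp_add]
    ring
  rw [h, norm_mul, Complex.norm_exp_ofReal_mul_I, mul_one, ← Complex.normSq_eq_norm_sq,
    Complex.normSq_apply]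
  simp only [Complex.add_re, Complex.add_im, Complex.ofReal_re, Complex.ofReal_im,
    Complex.re_ofReal_mul, Complex.im_ofReal_mul, Complex.exp_ofReal_mul_I_re,
    Complex.exp_ofReal_mul_I_im]
  linear_combination r ^ 2 * Real.sin_sq_add_cos_sq t

/-- A disc cuts out of any circle a single arc, which is split at its midpoint into two arcs that
are proper even when the whole circle lies in the disc. So a bound on arc integrals of `g` bounds
the integral over the circle of the restriction of `g` to the disc. -/
theorem abs_circle_integral_indicator_le {g : ℂ → ℝ} {r κ N : ℝ} (hr : 0 ≤ r) (hN : 0 < N)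
    (hκ : 0 ≤ κ)
    (harc : ∀ c : ℂ, ∀ s t : ℝ, s < t → t < s + 2 * Real.pi →
      |∫ θ in s..t, g (c + r * Complex.exp (θ * Complex.I))| ≤ κ) (x z : ℂ) (hz : ‖z‖ = r) :
    |∫ θ in (0 : ℝ)..2 * Real.pi,
      (Metric.ball 0 N).indicator g (x + z * Complex.exp (θ * Complex.I))| ≤ 2 * κ := by
  have hpi := Real.pi_pos
  set h : ℝ → ℝ := fun θ => (Metric.ball 0 N).indicator g (x + r * Complex.exp (θ * Complex.I))
    with hh
  have hper : Function.Periodic h (2 * Real.pi) := fun θ => by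
    simp only [hh]
    push_cast
    rw [add_mul, Complex.exp_add, Complex.exp_two_pi_mul_I, mul_one]
  set β := x.arg
  -- Measure angles from the direction of `x`, so that the distance to `0` depends on `cos t` only.
  have hshift : ∫ θ in (0 : ℝ)..2 * Real.pi,
      (Metric.ball 0 N).indicator g (x + z * Complex.exp (θ * Complex.I)) =
      ∫ t in (0 : ℝ)..2 * Real.pi, h (t + β) := by
    have e1 : ∀ θ : ℝ, (Metric.ball 0 N).indicator g (x + z * Complex.exp (θ * Complex.I)) =
        h (θ + z.arg) := fun θ => by
      simp only [hh]
      conv_lhs => rw [← Complex.norm_mul_exp_arg_mul_I z, hz]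
      push_cast
      rw [add_mul, Complex.exp_add, mul_assoc, mul_comm (Complex.exp (z.arg * Complex.I))]
    simp only [e1]
    rw [intervalIntegral.integral_comp_add_right, intervalIntegral.integral_comp_add_right,
      zero_add, zero_add, add_comm _ z.arg, add_comm _ β]
    exact hper.intervalIntegral_add_eq _ _
  rw [hshift]
  obtain ⟨τ, ⟨hτ0, hτπ⟩, hτ⟩ := exists_forall_add_mul_cos_lt_iff (‖x‖ ^ 2 + r ^ 2) (N ^ 2)
    (b := 2 * r * ‖x‖) (by positivity)
  set k : ℝ → ℝ := fun t => g (x + r * Complex.exp ((t + β : ℝ) * Complex.I)) with hk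
  have hmem : ∀ t ∈ Set.Ioo 0 (2 * Real.pi),
      h (t + β) = (Set.Ioo τ (2 * Real.pi - τ)).indicator k t := by
    intro t ht
    have : x + r * Complex.exp ((t + β : ℝ) * Complex.I) ∈ Metric.ball (0 : ℂ) N ↔
        t ∈ Set.Ioo τ (2 * Real.pi - τ) := by
      rw [mem_ball_zero_iff, ← sq_lt_sq₀ (norm_nonneg _) hN.le]
      conv_lhs => rw [← Complex.norm_mul_exp_arg_mul_I x]
      rw [norm_sq_add_mul_exp_mul_I, hτ t ht]
      rfl
    simp only [hh, hk, Set.indicator, this]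
  have hint : ∫ t in (0 : ℝ)..2 * Real.pi, h (t + β) =
      ∫ t in τ..2 * Real.pi - τ, k t := by
    rw [intervalIntegral.integral_of_le (by linarith), intervalIntegral.integral_of_le (by linarith),
      integral_Ioc_eq_integral_Ioo, integral_Ioc_eq_integral_Ioo,
      setIntegral_congr_fun measurableSet_Ioo hmem, setIntegral_indicator measurableSet_Ioo,
      Set.inter_eq_right.2 (Set.Ioo_subset_Ioo hτ0 (by linarith))]
  rw [hint]
  have key : ∀ s t : ℝ, s ≤ t → t < s + 2 * Real.pi → |∫ θ in s..t, k θ| ≤ κ := by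
    intro s t hst hts
    rcases hst.eq_or_lt with rfl | hst
    · simpa using hκ
    · simp only [hk]
      rw [intervalIntegral.integral_comp_add_right
        (fun θ => g (x + r * Complex.exp (θ * Complex.I)))]
      exact harc x _ _ (by linarith) (by linarith)
  by_cases hI : IntervalIntegrable k volume τ (2 * Real.pi - τ)
  · have hs : Set.uIcc τ Real.pi ⊆ Set.uIcc τ (2 * Real.pi - τ) := by
      rw [Set.uIcc_of_le hτπ, Set.uIcc_of_le (by linarith)]
      exact Set.Icc_subset_Icc le_rfl (by linarith)
    have hs' : Set.uIcc Real.pi (2 * Real.pi - τ) ⊆ Set.uIcc τ (2 * Real.pi - τ) := by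
      rw [Set.uIcc_of_le (by linarith), Set.uIcc_of_le (by linarith)]
      exact Set.Icc_subset_Icc hτπ le_rfl
    rw [← intervalIntegral.integral_add_adjacent_intervals (hI.mono_set hs) (hI.mono_set hs')]
    refine (abs_add_le _ _).trans ?_
    linarith [key τ Real.pi hτπ (by linarith), key Real.pi (2 * Real.pi - τ) (by linarith)
      (by linarith)]
  · rw [intervalIntegral.integral_undef hI, abs_zero]
    positivity

/-! ### Cellwise constant functions truncated to a disc -/

/-- The function on the plane, identified with `ℂ`, whose value on the unit cell with lower left
corner `m + n i` is `a m n`. -/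
noncomputable def cellFunction (a : ℤ → ℤ → ℝ) (z : ℂ) : ℝ := a ⌊z.re⌋ ⌊z.im⌋

theorem measurable_cellFunction (a : ℤ → ℤ → ℝ) : Measurable (cellFunction a) := by
  have h : Measurable fun p : ℤ × ℤ => a p.1 p.2 := Measurable.of_discrete
  exact h.comp ((Int.measurable_floor.comp Complex.measurable_re).prodMk
    (Int.measurable_floor.comp Complex.measurable_im))

/-- The function `cellFunction a` cut off to the disc of radius `N` about the origin. -/
noncomputable def truncatedCellFunction (a : ℤ → ℤ → ℝ) (N : ℝ) : ℂ → ℝ :=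
  (Metric.ball 0 N).indicator (cellFunction a)

theorem volume_real_ball {r : ℝ} (hr : 0 ≤ r) (c : ℂ) :
    volume.real (Metric.ball c r) = Real.pi * r ^ 2 := by
  rw [Measure.real, Complex.volume_ball, ENNReal.toReal_mul, ENNReal.toReal_pow,
    ENNReal.toReal_ofReal hr, mul_comm]
  rfl

theorem measurable_truncatedCellFunction (a : ℤ → ℤ → ℝ) (N : ℝ) :
    Measurable (truncatedCellFunction a N) :=
  (measurable_cellFunction a).indicator Metric.isOpen_ball.measurableSet

theorem abs_truncatedCellFunction_le {a : ℤ → ℤ → ℝ} (ha : ∀ m n, |a m n| = 1) (N : ℝ) (x : ℂ) :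
    |truncatedCellFunction a N x| ≤ 1 := by
  unfold truncatedCellFunction Set.indicator
  split_ifs
  · exact (ha _ _).le
  · simp

theorem integrable_truncatedCellFunction {a : ℤ → ℤ → ℝ} (ha : ∀ m n, |a m n| = 1) (N : ℝ) :
    Integrable (truncatedCellFunction a N) := by
  refine (integrable_indicator_iff Metric.isOpen_ball.measurableSet).2 ?_
  have : IsFiniteMeasure (volume.restrict (Metric.ball (0 : ℂ) N)) :=
    ⟨by rw [Measure.restrict_apply_univ]; exact measure_ball_lt_top⟩
  exact Integrable.of_bound (measurable_cellFunction a).aestronglyMeasurable 1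
    (Filter.Eventually.of_forall fun x => (ha _ _).le)

/-- The centre of the unit cell with lower left corner `m + n i`. -/
noncomputable def cellCenter (p : ℤ × ℤ) : ℂ := ⟨p.1 + 1 / 2, p.2 + 1 / 2⟩

theorem abs_re_im_sub_lt {p : ℤ × ℤ} {z : ℂ} (hz : z ∈ Metric.ball (cellCenter p) (1 / 2)) :
    |z.re - (p.1 + 1 / 2)| < 1 / 2 ∧ |z.im - (p.2 + 1 / 2)| < 1 / 2 := by
  rw [Metric.mem_ball, dist_eq_norm] at hz
  exact ⟨(Complex.abs_re_le_norm (z - cellCenter p)).trans_lt hz,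
    (Complex.abs_im_le_norm (z - cellCenter p)).trans_lt hz⟩

theorem floor_eq_of_mem_ball {p : ℤ × ℤ} {z : ℂ} (hz : z ∈ Metric.ball (cellCenter p) (1 / 2)) :
    (⌊z.re⌋, ⌊z.im⌋) = p := by
  obtain ⟨h1, h2⟩ := abs_re_im_sub_lt hz
  rw [abs_lt] at h1 h2
  refine Prod.ext (Int.floor_eq_iff.2 ⟨?_, ?_⟩) (Int.floor_eq_iff.2 ⟨?_, ?_⟩) <;> linarith

/-- The lower left corners of the `4M²` cells that make up the square `[-M, M)²`. -/
noncomputable def squareCells (M : ℕ) : Finset (ℤ × ℤ) :=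
  Finset.Ico (-M : ℤ) M ×ˢ Finset.Ico (-M : ℤ) M

theorem card_squareCells (M : ℕ) : (squareCells M).card = 4 * M ^ 2 := by
  rw [squareCells, Finset.card_product, Int.card_Ico]
  have : ((M : ℤ) - -M).toNat = 2 * M := by omega
  rw [this]
  ring

theorem truncatedCellFunction_eq {a : ℤ → ℤ → ℝ} {M : ℕ} {p : ℤ × ℤ} (hp : p ∈ squareCells M)
    {z : ℂ} (hz : z ∈ Metric.ball (cellCenter p) (1 / 2)) :
    truncatedCellFunction a (2 * M) z = a p.1 p.2 := by
  have hfl := floor_eq_of_mem_ball hz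
  have hmem : z ∈ Metric.ball (0 : ℂ) (2 * M) := by
    obtain ⟨h1, h2⟩ := abs_re_im_sub_lt hz
    rw [abs_lt] at h1 h2
    simp only [squareCells, Finset.mem_product, Finset.mem_Ico] at hp
    obtain ⟨⟨h3, h4⟩, h5, h6⟩ := hp
    have h3' : -(M : ℝ) ≤ p.1 := by exact_mod_cast h3
    have h4' : (p.1 : ℝ) + 1 ≤ M := by exact_mod_cast h4
    have h5' : -(M : ℝ) ≤ p.2 := by exact_mod_cast h5
    have h6' : (p.2 : ℝ) + 1 ≤ M := by exact_mod_cast h6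
    rw [mem_ball_zero_iff]
    refine (Complex.norm_le_abs_re_add_abs_im z).trans_lt ?_
    have : |z.re| < M := abs_lt.2 ⟨by linarith, by linarith⟩
    have : |z.im| < M := abs_lt.2 ⟨by linarith, by linarith⟩
    linarith
  rw [truncatedCellFunction, Set.indicator_of_mem hmem, cellFunction, ← hfl]

theorem volume_real_biUnion_ball_cellCenter (M : ℕ) :
    volume.real (⋃ p ∈ squareCells M, Metric.ball (cellCenter p) (1 / 4)) =
      Real.pi * M ^ 2 / 4 := by
  have hdisj : ((squareCells M : Finset (ℤ × ℤ)) : Set (ℤ × ℤ)).PairwiseDisjoint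
      fun p => Metric.ball (cellCenter p) (1 / 4) := by
    intro p _ q _ hpq
    refine Set.disjoint_left.2 fun z hz hz' => hpq ?_
    have hsub : ∀ c : ℂ, Metric.ball c (1 / 4) ⊆ Metric.ball c (1 / 2) := fun c =>
      Metric.ball_subset_ball (by norm_num)
    rw [← floor_eq_of_mem_ball (hsub _ hz), ← floor_eq_of_mem_ball (hsub _ hz')]
  rw [measureReal_biUnion_finset hdisj (fun _ _ => Metric.isOpen_ball.measurableSet)
    (fun _ _ => measure_ball_lt_top.ne)]
  simp only [volume_real_ball (show (0 : ℝ) ≤ 1 / 4 by norm_num), Finset.sum_const,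
    card_squareCells, nsmul_eq_mul]
  push_cast
  ring

/-- Averages over discs of radius at most `1/4` detect the `L²` mass: such a disc lies within one
cell as soon as its centre is within `1/4` of the centre of the cell. -/
theorem integral_sq_disc_average_ge {a : ℤ → ℤ → ℝ} (ha : ∀ m n, |a m n| = 1) (M : ℕ) {w : ℂ}
    (hw : ‖w‖ ≤ 1 / 4) :
    Real.pi ^ 2 * (Real.pi * M ^ 2 / 4) ≤
      ∫ x, (∫ u in Metric.ball (0 : ℂ) 1, truncatedCellFunction a (2 * M) (x + w * u)) ^ 2 := by
  have : IsFiniteMeasure (volume.restrict (Metric.ball (0 : ℂ) 1)) :=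
    ⟨by rw [Measure.restrict_apply_univ]; exact measure_ball_lt_top⟩
  have hint := integrable_sq_average (μ := volume.restrict (Metric.ball (0 : ℂ) 1))
    (measurable_truncatedCellFunction a (2 * M)) (integrable_truncatedCellFunction ha _)
    (abs_truncatedCellFunction_le ha _) (p := fun u => w * u) (by fun_prop)
  refine le_trans ?_ (mul_meas_ge_le_integral_of_nonneg
    (Filter.Eventually.of_forall fun x => sq_nonneg _) hint (Real.pi ^ 2))
  refine mul_le_mul_of_nonneg_left ?_ (by positivity)
  rw [← volume_real_biUnion_ball_cellCenter]
  refine measureReal_mono (fun x hx => ?_) (hint.measure_ge_lt_top (by positivity)).ne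
  simp only [Set.mem_iUnion] at hx
  obtain ⟨p, hp, hx⟩ := hx
  have heq : ∀ u ∈ Metric.ball (0 : ℂ) 1,
      truncatedCellFunction a (2 * M) (x + w * u) = a p.1 p.2 := by
    intro u hu
    refine truncatedCellFunction_eq hp ?_
    rw [mem_ball_zero_iff] at hu
    rw [Metric.mem_ball, dist_eq_norm] at hx ⊢
    have h1 : ‖w * u‖ ≤ 1 / 4 := by
      rw [norm_mul]
      nlinarith [norm_nonneg w, norm_nonneg u]
    have h2 : x + w * u - cellCenter p = (x - cellCenter p) + w * u := by ring
    rw [h2]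
    linarith [norm_add_le (x - cellCenter p) (w * u)]
  rw [Set.mem_ofPred_eq]
  rw [setIntegral_congr_fun Metric.isOpen_ball.measurableSet heq, setIntegral_const,
    volume_real_ball zero_le_one, smul_eq_mul, mul_pow, ← sq_abs (a _ _), ha]
  simp

/-! ### Lower and upper bounds for the circle energy -/

instance isFiniteMeasure_restrict_unitBall :
    IsFiniteMeasure (volume.restrict (Metric.ball (0 : ℂ) 1)) :=
  ⟨by rw [Measure.restrict_apply_univ]; exact measure_ball_lt_top⟩

/-- The total energy of the integrals of `F` over the circles of centre `x` and radius
`N |u' - u|`, where `x` runs through the plane and `u`, `u'` through the unit disc. Integrals over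
circles are taken with respect to the angle. -/
noncomputable def circleEnergy (F : ℂ → ℝ) (N : ℝ) : ℝ :=
  ∫ w : ℂ × ℂ, (∫ x, (∫ t in Set.Ioc 0 (2 * Real.pi),
      F (x + (w.2 - w.1) * (N * Complex.exp (t * Complex.I)))) ^ 2)
    ∂((volume.restrict (Metric.ball 0 1)).prod (volume.restrict (Metric.ball 0 1)))

theorem norm_exp_mul_I_sub_le (s t : ℝ) :
    ‖Complex.exp (t * Complex.I) - Complex.exp (s * Complex.I)‖ ≤ |t - s| := by
  have h : Complex.exp (t * Complex.I) - Complex.exp (s * Complex.I) =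
      Complex.exp (s * Complex.I) * (Complex.exp (Complex.I * (t - s : ℝ)) - 1) := by
    rw [mul_sub, ← Complex.exp_add, mul_one]
    push_cast
    ring_nf
  rw [h, norm_mul, Complex.norm_exp_ofReal_mul_I, one_mul]
  exact Real.norm_exp_I_mul_ofReal_sub_one_le

/-- By duality the energy is an integral over pairs of angles `t`, `t'` of energies of disc
averages, of discs of radius `2M |exp (i t') - exp (i t)|`. The pairs at distance at most `1/(8M)`
alone contribute the claimed amount. -/
theorem circleEnergy_ge {a : ℤ → ℤ → ℝ} (ha : ∀ m n, |a m n| = 1) {M : ℕ} (hM : 0 < M) :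
    Real.pi ^ 3 * M / 32 ≤ circleEnergy (truncatedCellFunction a (2 * M)) (2 * M) := by
  have hpi := Real.pi_gt_three
  have hM' : (0 : ℝ) < M := by exact_mod_cast hM
  set F := truncatedCellFunction a (2 * M)
  set μ := (volume : Measure ℝ).restrict (Set.Ioc 0 (2 * Real.pi)) with hμ
  set ν := (volume : Measure ℂ).restrict (Metric.ball 0 1) with hν
  set q : ℝ → ℂ := fun t => ((2 * M : ℝ) : ℂ) * Complex.exp (t * Complex.I) with hq
  have hqm : Measurable q := by fun_prop
  have hm : Measurable F := measurable_truncatedCellFunction a _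
  have hi : Integrable F := integrable_truncatedCellFunction ha _
  have hb : ∀ x, |F x| ≤ 1 := abs_truncatedCellFunction_le ha _
  have hcomm := integral_energy_comm (μ := μ) (ν := ν) hm hi hb hqm measurable_id
  have hint := integrable_energy (μ := μ) (ν := ν) hm hi hb hqm measurable_id
  simp only [id] at hcomm hint
  rw [circleEnergy, hcomm, integral_prod _ hint]
  set E : ℝ := Real.pi ^ 2 * (Real.pi * M ^ 2 / 4) with hE
  set δ : ℝ := 1 / (8 * M) with hδ
  have hδ0 : 0 < δ := by positivity
  have hδ1 : δ ≤ 1 := by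
    rw [hδ, div_le_one (by positivity)]
    have : (1 : ℝ) ≤ M := by exact_mod_cast hM
    linarith
  have hinner : ∀ᵐ s ∂μ, (Set.Ioc (0 : ℝ) 1).indicator (fun _ => E * δ) s ≤
      ∫ t, (∫ x, (∫ u, F (x + (q t - q s) * u) ∂ν) ^ 2) ∂μ := by
    filter_upwards [hint.prod_right_ae] with s hs
    by_cases hs1 : s ∈ Set.Ioc (0 : ℝ) 1
    · rw [Set.indicator_of_mem hs1]
      refine le_trans ?_ (mul_meas_ge_le_integral_of_nonneg
        (Filter.Eventually.of_forall fun t => integral_nonneg fun x => sq_nonneg _) hs E)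
      refine mul_le_mul_of_nonneg_left ?_ (by positivity)
      have hvol : μ.real (Set.Ioc s (s + δ)) = δ := by
        rw [hμ, measureReal_restrict_apply measurableSet_Ioc,
          Set.inter_eq_left.2 (Set.Ioc_subset_Ioc hs1.1.le (by linarith [hs1.2])),
          Real.volume_real_Ioc_of_le (by linarith)]
        ring
      rw [← hvol]
      refine measureReal_mono (fun t ht => ?_)
      refine integral_sq_disc_average_ge ha M ?_
      rw [hq, ← mul_sub, norm_mul, Complex.norm_real, Real.norm_of_nonneg (by positivity)]
      have h1 : |t - s| ≤ δ := by
        rw [abs_of_pos (by linarith [ht.1])]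
        linarith [ht.2]
      calc 2 * (M : ℝ) * _ ≤ 2 * M * δ :=
            mul_le_mul_of_nonneg_left ((norm_exp_mul_I_sub_le s t).trans h1) (by positivity)
        _ = 1 / 4 := by rw [hδ]; field_simp; norm_num
    · rw [Set.indicator_of_notMem hs1]
      exact integral_nonneg fun t => integral_nonneg fun x => sq_nonneg _
  refine le_trans (le_of_eq ?_) (integral_mono_ae
    ((integrable_const (E * δ)).indicator measurableSet_Ioc) hint.integral_prod_left hinner)
  rw [integral_indicator measurableSet_Ioc, hμ, Measure.restrict_restrict measurableSet_Ioc,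
    Set.inter_eq_left.2 (Set.Ioc_subset_Ioc le_rfl (by linarith)), setIntegral_const,
    Real.volume_real_Ioc_of_le zero_le_one, hE, hδ, smul_eq_mul]
  field_simp
  norm_num

theorem integrableOn_norm_inv_ball :
    IntegrableOn (fun z : ℂ => ‖z‖⁻¹) (Metric.ball 0 2) := by
  rw [← integrable_indicator_iff Metric.isOpen_ball.measurableSet]
  have h : (Metric.ball (0 : ℂ) 2).indicator (fun z : ℂ => ‖z‖⁻¹) =
      fun z => (Set.Iio (2 : ℝ)).indicator (fun y => y⁻¹) ‖z‖ := by
    ext z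
    simp [Set.indicator]
  rw [h, integrable_fun_norm_addHaar, Complex.finrank_real_complex]
  refine IntegrableOn.congr_fun (f := (Set.Iio (2 : ℝ)).indicator fun _ => 1) ?_ ?_ measurableSet_Ioi
  · rw [IntegrableOn, integrable_indicator_iff measurableSet_Iio, IntegrableOn,
      Measure.restrict_restrict measurableSet_Iio]
    refine integrableOn_const (ne_of_lt ?_)
    rw [Set.inter_comm, Set.Ioi_inter_Iio]
    exact measure_Ioo_lt_top
  · intro y hy
    have : y ≠ 0 := ne_of_gt hy
    by_cases h2 : y < 2 <;> simp [Set.indicator, h2, this]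

/-- Only circles of radius at most `2N` occur, and only those with centre in the disc of radius
`3N` meet the disc of radius `N`. The bound `D / |z|` covers the radii above `ρ`, the trivial bound
`4 π ^ 2` those up to `ρ`. -/
theorem circleEnergy_le {a : ℤ → ℤ → ℝ} (ha : ∀ m n, |a m n| = 1) {N ρ D : ℝ} (hN : 0 < N)
    (hρ : 0 ≤ ρ) (hD : 0 ≤ D)
    (h : ∀ x z : ℂ, ρ < ‖z‖ → (∫ t in Set.Ioc 0 (2 * Real.pi),
      truncatedCellFunction a N (x + z * Complex.exp (t * Complex.I))) ^ 2 ≤ D / ‖z‖) :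
    circleEnergy (truncatedCellFunction a N) N ≤
      9 * Real.pi ^ 2 * (D * N * (∫ z in Metric.ball (0 : ℂ) 2, ‖z‖⁻¹) +
        4 * Real.pi ^ 3 * ρ ^ 2) := by
  have hpi := Real.pi_pos
  set F := truncatedCellFunction a N with hF
  set μ := (volume : Measure ℝ).restrict (Set.Ioc 0 (2 * Real.pi)) with hμ
  set ν := (volume : Measure ℂ).restrict (Metric.ball 0 1) with hν
  set q : ℝ → ℂ := fun t => (N : ℂ) * Complex.exp (t * Complex.I) with hq
  have hqm : Measurable q := by fun_prop
  have hm : Measurable F := measurable_truncatedCellFunction a _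
  have hi : Integrable F := integrable_truncatedCellFunction ha _
  have hb : ∀ x, |F x| ≤ 1 := abs_truncatedCellFunction_le ha _
  set J : ℂ → ℝ := fun z => ∫ x, (∫ t, F (x + z * q t) ∂μ) ^ 2 with hJ
  have hJint : Integrable (fun w : ℂ × ℂ => J (w.2 - w.1)) (ν.prod ν) :=
    integrable_energy (μ := ν) (ν := μ) hm hi hb measurable_id hqm
  set P : ℂ → ℝ := (Metric.ball (0 : ℂ) 2).indicator fun z => ‖z‖⁻¹ with hP
  set Q : ℂ → ℝ := (Metric.closedBall (0 : ℂ) (ρ / N)).indicator fun _ => 1 with hQ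
  set c : ℂ → ℝ := fun z => D / N * P z + 4 * Real.pi ^ 2 * Q z with hc
  have hPint : Integrable P :=
    (integrable_indicator_iff Metric.isOpen_ball.measurableSet).2 integrableOn_norm_inv_ball
  have hQint : Integrable Q :=
    (integrable_indicator_iff Metric.isClosed_closedBall.measurableSet).2
      (integrableOn_const measure_closedBall_lt_top.ne)
  have hcint : Integrable c := (hPint.const_mul _).add (hQint.const_mul _)
  have hP0 : ∀ z, 0 ≤ P z := fun z => Set.indicator_nonneg (fun z _ => by positivity) z
  have hQ0 : ∀ z, 0 ≤ Q z := fun z => Set.indicator_nonneg (fun z _ => zero_le_one) z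
  have hc0 : ∀ z, 0 ≤ c z := fun z =>
    add_nonneg (mul_nonneg (by positivity) (hP0 z)) (mul_nonneg (by positivity) (hQ0 z))
  have hpoint : ∀ x z : ℂ, ‖z‖ < 2 → (∫ t, F (x + z * q t) ∂μ) ^ 2 ≤ c z := by
    intro x z hz
    rcases le_or_gt (N * ‖z‖) ρ with hle | hlt
    · have h1 : |∫ t, F (x + z * q t) ∂μ| ≤ 1 * μ.real Set.univ :=
        norm_integral_le_of_norm_le_const (f := fun t => F (x + z * q t))
          (Filter.Eventually.of_forall fun t => hb _)
      have h2 : μ.real Set.univ = 2 * Real.pi := by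
        rw [hμ, measureReal_restrict_apply_univ, Real.volume_real_Ioc_of_le (by positivity),
          sub_zero]
      have h3 : Q z = 1 := by
        rw [hQ, Set.indicator_of_mem]
        rw [mem_closedBall_zero_iff, le_div_iff₀ hN, mul_comm]
        exact hle
      rw [h2, one_mul] at h1
      have h4 : (∫ t, F (x + z * q t) ∂μ) ^ 2 ≤ (2 * Real.pi) ^ 2 := by
        rw [← sq_abs]
        exact pow_le_pow_left₀ (abs_nonneg _) h1 2
      have h5 : 0 ≤ D / N * P z := mul_nonneg (by positivity) (hP0 z)
      simp only [hc, h3]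
      linarith
    · have hnorm : ‖z * (N : ℂ)‖ = N * ‖z‖ := by
        rw [norm_mul, Complex.norm_real, Real.norm_of_nonneg hN.le, mul_comm]
      have h1 := h x (z * N) (by rwa [hnorm])
      have h3 : P z = ‖z‖⁻¹ := by
        rw [hP, Set.indicator_of_mem]
        rwa [mem_ball_zero_iff]
      have h5 : 0 ≤ 4 * Real.pi ^ 2 * Q z := mul_nonneg (by positivity) (hQ0 z)
      simp only [hq, hc, h3, ← mul_assoc]
      refine h1.trans ?_
      rw [hnorm, ← div_div, div_eq_mul_inv (D / N)]
      linarith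
  have hzero : ∀ x z : ℂ, ‖z‖ < 2 → x ∉ Metric.ball (0 : ℂ) (3 * N) →
      (∫ t, F (x + z * q t) ∂μ) ^ 2 = 0 := by
    intro x z hz hx
    have : ∀ t, F (x + z * q t) = 0 := by
      intro t
      rw [hF, truncatedCellFunction, Set.indicator_of_notMem]
      rw [mem_ball_zero_iff, not_lt] at hx ⊢
      have h1 : ‖z * q t‖ = ‖z‖ * N := by
        rw [hq, norm_mul, norm_mul, Complex.norm_exp_ofReal_mul_I, mul_one, Complex.norm_real,
          Real.norm_of_nonneg hN.le]
      have h2 := norm_sub_le (x + z * q t) (z * q t)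
      rw [add_sub_cancel_right, h1] at h2
      nlinarith
    simp [this]
  have hJle : ∀ z : ℂ, ‖z‖ < 2 → J z ≤ 9 * Real.pi * N ^ 2 * c z := by
    intro z hz
    have h1 : J z ≤ ∫ x, (Metric.ball (0 : ℂ) (3 * N)).indicator (fun _ => c z) x := by
      refine integral_mono_of_nonneg (Filter.Eventually.of_forall fun x => sq_nonneg _)
        ((integrable_indicator_iff Metric.isOpen_ball.measurableSet).2
          (integrableOn_const measure_ball_lt_top.ne)) (Filter.Eventually.of_forall fun x => ?_)
      by_cases hx : x ∈ Metric.ball (0 : ℂ) (3 * N)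
      · rw [Set.indicator_of_mem hx]
        exact hpoint x z hz
      · rw [Set.indicator_of_notMem hx]
        exact (hzero x z hz hx).le
    rw [integral_indicator Metric.isOpen_ball.measurableSet, setIntegral_const,
      volume_real_ball (by positivity), smul_eq_mul] at h1
    linarith
  have hinner : ∀ u ∈ Metric.ball (0 : ℂ) 1,
      ∫ u', J (u' - u) ∂ν ≤ 9 * Real.pi * N ^ 2 * ∫ z, c z := by
    intro u hu
    have hcu : Integrable fun u' => 9 * Real.pi * N ^ 2 * c (u' - u) :=
      (hcint.comp_sub_right u).const_mul _
    calc ∫ u', J (u' - u) ∂ν ≤ ∫ u', 9 * Real.pi * N ^ 2 * c (u' - u) ∂ν := by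
          refine integral_mono_of_nonneg
            (Filter.Eventually.of_forall fun x => integral_nonneg fun _ => sq_nonneg _)
            hcu.integrableOn ?_
          filter_upwards [ae_restrict_mem Metric.isOpen_ball.measurableSet] with u' hu'
          rw [mem_ball_zero_iff] at hu hu'
          exact hJle _ (by linarith [norm_sub_le u' u])
      _ ≤ ∫ u', 9 * Real.pi * N ^ 2 * c (u' - u) :=
          setIntegral_le_integral hcu
            (Filter.Eventually.of_forall fun u' => mul_nonneg (by positivity) (hc0 _))
      _ = 9 * Real.pi * N ^ 2 * ∫ z, c z := by
          rw [integral_const_mul, integral_sub_right_eq_self c u]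
  have hctot : ∫ z, c z = D / N * (∫ z in Metric.ball (0 : ℂ) 2, ‖z‖⁻¹) +
      4 * Real.pi ^ 2 * (Real.pi * (ρ / N) ^ 2) := by
    simp only [hc]
    rw [integral_add (hPint.const_mul _) (hQint.const_mul _), integral_const_mul,
      integral_const_mul, hP, hQ, integral_indicator Metric.isOpen_ball.measurableSet,
      integral_indicator Metric.isClosed_closedBall.measurableSet, setIntegral_const,
      Measure.real, Complex.volume_closedBall, ENNReal.toReal_mul, ENNReal.toReal_pow,
      ENNReal.toReal_ofReal (by positivity), smul_eq_mul, mul_one, mul_comm ((ρ / N) ^ 2)]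
    rfl
  have hsum : circleEnergy F N ≤ Real.pi * (9 * Real.pi * N ^ 2 * ∫ z, c z) := by
    calc circleEnergy F N = ∫ u, (∫ u', J (u' - u) ∂ν) ∂ν := integral_prod _ hJint
      _ ≤ ∫ _u in Metric.ball (0 : ℂ) 1, 9 * Real.pi * N ^ 2 * ∫ z, c z :=
          setIntegral_mono_on hJint.integral_prod_left (integrable_const _)
            Metric.isOpen_ball.measurableSet hinner
      _ = _ := by
          rw [setIntegral_const, volume_real_ball zero_le_one, smul_eq_mul, one_pow, mul_one]
  rw [hctot] at hsum
  refine hsum.trans (le_of_eq ?_)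
  field_simp

/-! ### Checkerboard colorings -/

theorem IsCheckerboardColoring.apply_eq {f : Plane → ℝ} (hf : IsCheckerboardColoring f)
    (p : Plane) : f p = f !₂[(⌊p 0⌋ : ℝ), (⌊p 1⌋ : ℝ)] := by
  refine hf.const_on_cell ⌊p 0⌋ ⌊p 1⌋ _
    ⟨⟨Int.floor_le _, Int.lt_floor_add_one _⟩, Int.floor_le _, Int.lt_floor_add_one _⟩ _ ?_
  simp [unitCell]

theorem IsCheckerboardColoring.apply_point {f : Plane → ℝ} (hf : IsCheckerboardColoring f)
    (I : CircularArc) (c : ℂ) (hc : I.center = !₂[c.re, c.im]) (θ : ℝ) :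
    f (I.point θ) = cellFunction (fun m n => f !₂[(m : ℝ), (n : ℝ)])
      (c + I.radius * Complex.exp (θ * Complex.I)) := by
  rw [hf.apply_eq, cellFunction]
  simp [CircularArc.point, hc, Complex.exp_ofReal_mul_I_re, Complex.exp_ofReal_mul_I_im]

/-- A bound `C √r` on the integrals over all arcs of radius `r` becomes `2 C √r` for a circle of
radius `r` cut off to a disc. Dividing by `r`, because `circleEnergy` integrates over angles, and
squaring gives `4 C² / r`. -/
theorem sq_circle_integral_le {f : Plane → ℝ} (hf : IsCheckerboardColoring f) {C r N : ℝ}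
    (hC : 0 ≤ C) (hr : 0 < r) (hN : 0 < N)
    (harc : ∀ I : CircularArc, I.radius = r → |I.integral f| ≤ C * Real.sqrt r) (x z : ℂ)
    (hz : ‖z‖ = r) :
    (∫ t in Set.Ioc 0 (2 * Real.pi), truncatedCellFunction (fun m n => f !₂[(m : ℝ), (n : ℝ)]) N
      (x + z * Complex.exp (t * Complex.I))) ^ 2 ≤ 4 * C ^ 2 / r := by
  have hsq := Real.sq_sqrt hr.le
  have h := abs_circle_integral_indicator_le
    (g := cellFunction fun m n => f !₂[(m : ℝ), (n : ℝ)]) (κ := C * Real.sqrt r / r) hr.le hN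
    (by positivity) (fun c s t hst hts => ?_) x z hz
  · rw [intervalIntegral.integral_of_le (by positivity)] at h
    rw [← sq_abs]
    refine (pow_le_pow_left₀ (abs_nonneg _) h 2).trans (le_of_eq ?_)
    rw [mul_pow, div_pow, mul_pow, hsq]
    field_simp
    ring
  · set I : CircularArc := ⟨!₂[c.re, c.im], r, s, t, hr, hst, hts⟩
    have h1 := harc I rfl
    have h2 : I.integral f = (∫ θ in s..t, cellFunction (fun m n => f !₂[(m : ℝ), (n : ℝ)])
        (c + r * Complex.exp (θ * Complex.I))) * r := by
      rw [CircularArc.integral, ← intervalIntegral.integral_mul_const]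
      simp only [hf.apply_point I c rfl]
      rfl
    rwa [h2, abs_mul, abs_of_pos hr, ← le_div_iff₀ hr] at h1

theorem theorem1 :
    ∃ C : ℝ, 0 < C ∧
      ∀ f : Plane → ℝ, IsCheckerboardColoring f →
        ∀ R₀ : ℝ, ∃ R : ℝ, R₀ < R ∧ 0 < R ∧
          ∃ I : CircularArc, I.radius = R ∧ C * Real.sqrt R ≤ |I.integral f| := by
  set K : ℝ := ∫ z in Metric.ball (0 : ℂ) 2, ‖z‖⁻¹ with hK
  have hK0 : 0 ≤ K := integral_nonneg fun z => by positivity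
  -- The constant has to make `72 π² C² K` smaller than `π³ / 32`.
  refine ⟨1 / (100 * (K + 1)), by positivity, fun f hf R₀ => ?_⟩
  set C : ℝ := 1 / (100 * (K + 1)) with hC
  by_contra! hcon
  set ρ := max R₀ 0 with hρ
  have hρ0 : 0 ≤ ρ := le_max_right _ _
  have hpi := Real.pi_gt_three
  have ha : ∀ m n : ℤ, |f !₂[(m : ℝ), (n : ℝ)]| = 1 := fun m n => by
    rcases hf.eq_or_eq !₂[(m : ℝ), (n : ℝ)] with h | h <;> simp [h]
  obtain ⟨M, hM⟩ := exists_nat_gt (720 * Real.pi ^ 3 * ρ ^ 2)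
  have hM' : (0 : ℝ) < M := lt_of_le_of_lt (by positivity) hM
  have hlow := circleEnergy_ge ha (M := M) (by exact_mod_cast hM')
  have hup := circleEnergy_le ha (N := 2 * M) (ρ := ρ) (D := 4 * C ^ 2) (by positivity) hρ0
    (by positivity) (fun x z hz => by
      have hz0 : 0 < ‖z‖ := hρ0.trans_lt hz
      exact sq_circle_integral_le hf (by positivity) hz0 (by positivity)
        (fun I hI => (hcon _ ((le_max_left _ _).trans_lt hz) hz0 I hI).le) x z rfl)
  rw [← hK] at hup
  have hCK : C ^ 2 * K ≤ 1 / 10000 := by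
    rw [hC, div_pow, one_pow, div_mul_eq_mul_div, one_mul, div_le_div_iff₀ (by positivity)
      (by norm_num)]
    nlinarith [sq_nonneg K]
  have h1 : Real.pi ^ 2 * (Real.pi * M / 32) ≤
      Real.pi ^ 2 * (9 * (8 * (C ^ 2 * K) * M + 4 * Real.pi ^ 3 * ρ ^ 2)) := by
    linarith
  have h2 := le_of_mul_le_mul_left h1 (by positivity)
  have h3 : C ^ 2 * K * M ≤ 1 / 10000 * M := mul_le_mul_of_nonneg_right hCK hM'.le
  have h4 : 3 * (M : ℝ) ≤ Real.pi * M := mul_le_mul_of_nonneg_right hpi.le hM'.le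
  linarith
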